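/- Let $p$ be an odd prime, $F$ a field of characteristic $p$, and $L=\bigoplus_{i\ge 1}L_i$ an infinite-dimensional graded Lie algebra over $F$ of maximal class, that is, $\dim L_1=2$, $\dim L_i\le 1$ for $i\ge 2$, and $L$ is generated by $L_1$. For $i\ge 2$ let $C_i=\{u\in L_1 : [L_i,u]=0\}$ be its two-step centralizers. Suppose that not all $C_i$ equal $C_2$, and that the smallest $n\ge 2$ with $C_n\ne C_2$ is $n=2q$ (by a known theorem $n$ always has this form, with $q$ a power of $p$; $q$ is called the parameter of $L$). The first constituent is $C_2,\dots,C_{2q}$, by convention of length $2q$; every other constituent is a block $C_{i+1},\dots,C_{i+\ell}$ (of length $\ell\ge 1$), with $i \ge 2$, $C_i\ne C_2$, $C_{i+\ell}\ne C_2$ and $C_{i+1}=\dots=C_{i+\ell-1}=C_2$. Let $m\ge 0$ be an integer. Suppose that the sequence of constituent lengths of $L$ begins with $$2q,\ \underbrace{q,\dots,q}_{m},\ 2q,$$ and that the corresponding initial segment $C_2,C_3,\dots,C_{(m+4)q}$ of the sequence of two-step centralizers involves only the first two two-step centralizers $C_2$ and $C_{2q}$. Then $m=2r-3$ for some power $r=p^k$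 of $p$. -/

import Mathlib

namespace MaxClass

variable {F L : Type*} [Field F] [LieRing L] [LieAlgebra F L]

/-- A Lie algebra `L` with a grading `𝒜` is of maximal class: `L = ⨁_{i ≥ 1} 𝒜 i` (that is,
`𝒜 0 = 0`), `dim 𝒜 1 = 2`, `dim 𝒜 i ≤ 1` for `i ≥ 2`, and `L` is generated as a Lie algebra
by `𝒜 1`. -/
structure IsMaximalClass (𝒜 : ℕ → Submodule F L) [GradedLieAlgebra 𝒜] : Prop where
  zero_eq_bot : 𝒜 0 = ⊥
  rank_one : Module.rank F (𝒜 1) = 2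
  rank_le_one : ∀ i : ℕ, 2 ≤ i → Module.rank F (𝒜 i) ≤ 1
  generated : LieSubalgebra.lieSpan F L (𝒜 1 : Set L) = ⊤

/-- The two-step centralizer `C_i = C_{L_1}(L_i)`, used for `i ≥ 2`. -/
def twoStepCentralizer (𝒜 : ℕ → Submodule F L) (i : ℕ) : Submodule F L where
  carrier := {u | u ∈ 𝒜 1 ∧ ∀ v ∈ 𝒜 i, ⁅v, u⁆ = 0}
  zero_mem' := ⟨(𝒜 1).zero_mem, fun v _ => lie_zero v⟩
  add_mem' := fun ha hb => ⟨(𝒜 1).add_mem ha.1 hb.1, fun v hv => by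
    rw [lie_add, ha.2 v hv, hb.2 v hv, add_zero]⟩
  smul_mem' := fun c _ ha => ⟨(𝒜 1).smul_mem c ha.1, fun v hv => by
    rw [lie_smul, ha.2 v hv, smul_zero]⟩

/-- `C_2, …, C_n` is the first constituent, where `C_n` is the first occurrence of the second
two-step centralizer; by convention its length is `n`. -/
def IsFirstConstituent (𝒜 : ℕ → Submodule F L) (n : ℕ) : Prop :=
  2 ≤ n ∧ twoStepCentralizer 𝒜 n ≠ twoStepCentralizer 𝒜 2 ∧
    ∀ i, 2 ≤ i → i < n → twoStepCentralizer 𝒜 i = twoStepCentralizer 𝒜 2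

/-- `C_{i+1}, …, C_{i+n}` is a constituent (of length `n`) other than the first one. -/
def IsConstituent (𝒜 : ℕ → Submodule F L) (i n : ℕ) : Prop :=
  2 ≤ i ∧ 1 ≤ n ∧ twoStepCentralizer 𝒜 i ≠ twoStepCentralizer 𝒜 2 ∧
    twoStepCentralizer 𝒜 (i + n) ≠ twoStepCentralizer 𝒜 2 ∧
    ∀ j, 1 ≤ j → j < n → twoStepCentralizer 𝒜 (i + j) = twoStepCentralizer 𝒜 2

/-- The consecutive constituents that start right after `C_i` have lengths given by the list. -/
def ConstituentsFrom (𝒜 : ℕ → Submodule F L) : ℕ → List ℕ → Prop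
  | _, [] => True
  | i, n :: ns => IsConstituent 𝒜 i n ∧ ConstituentsFrom 𝒜 (i + n) ns

/-- The sequence of constituent lengths begins with the nonempty list `n :: ns`; the corresponding
initial segment of the sequence of two-step centralizers is `C_2, …, C_s` with
`s = (n :: ns).sum`. -/
def InitialConstituentLengths (𝒜 : ℕ → Submodule F L) : List ℕ → Prop
  | [] => True
  | n :: ns => IsFirstConstituent 𝒜 n ∧ ConstituentsFrom 𝒜 n ns

/-- `q` is the parameter: the second two-step centralizer first occurs in weight `2 q`. -/
def IsParameter (𝒜 : ℕ → Submodule F L) (q : ℕ) : Prop :=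
  IsFirstConstituent 𝒜 (2 * q)

/-- All of `C_2, …, C_s` are one of the first two two-step centralizers `C_2` and `C_{2q}`, where
`q` is the parameter. -/
def InvolvesOnlyFirstTwo (𝒜 : ℕ → Submodule F L) (q s : ℕ) : Prop :=
  ∀ i, 2 ≤ i → i ≤ s →
    twoStepCentralizer 𝒜 i = twoStepCentralizer 𝒜 2 ∨
      twoStepCentralizer 𝒜 i = twoStepCentralizer 𝒜 (2 * q)

end MaxClass

/-! Write `u x^k` for `u` bracketed `k` times on the right with `x`. Let `y` and `x` span `C_2` and
`C_{2q}`. The proof applies one first-constituent theorem, `exists_eq_two_mul_prime_pow`, twice.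

That theorem concerns two elements of any Lie algebra. Put `w = [y x^(n-1), y]`. Skew-symmetry of
`[y x^(n-1), y x^k]` gives `C(n-1, k) = (-1)^k` as long as `w x^k` is nonzero, so by Pascal's rule
`p` divides the first entries of row `n`. The Jacobi identity makes `p` divide further binomials,
governed by the first `w x^k` not killed by `y`. Together these force `n = 2 p^s`.

Applied to `L`, this shows that `q` is a power of `p`, so bracketing `q` times with `x` is a
derivation. Applied to the deflated algebra generated inside `End L` by that derivation and `ad v`,
where `v = y x^(q-1)`, it gives the claim: there the `m` constituents of length `q` followed by one
of length `2q` become a first constituent of length `m + 3`, so `m + 3 = 2 p^s`. Its nondegeneracy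
hypothesis comes from `pow_ne_zero_or_lie_ne_zero`, which rests on constituents having length at
least `q`. -/

namespace MaxClass

/-! ### Binomial coefficients modulo `p` -/

section Binomial

/-- A special case of Lucas' theorem. -/
theorem choose_prime_pow_modEq {p : ℕ} (hp : p.Prime) (a c r : ℕ) (hr : r < p ^ a) :
    (p ^ a * c + r).choose (p ^ a) ≡ c [MOD p] := by
  have := Fact.mk hp
  induction a generalizing r with
  | zero =>
    obtain rfl : r = 0 := by simpa using hr
    simp [Nat.ModEq.refl]
  | succ a ih =>
    refine (Choose.choose_modEq_choose_mod_mul_choose_div_nat (p := p)).trans ?_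
    have h1 : p ^ (a + 1) % p = 0 := by simp [pow_succ]
    have h2 : p ^ (a + 1) / p = p ^ a := by simp [pow_succ, hp.pos]
    have h3 : (p ^ (a + 1) * c + r) / p = p ^ a * c + r / p := by
      rw [pow_succ', mul_assoc, Nat.mul_add_div hp.pos]
    rw [h1, h2, h3, Nat.choose_zero_right, one_mul]
    exact ih _ (Nat.div_lt_of_lt_mul (by rwa [← pow_succ']))

/-- If `p ^ a` is the exact power of `p` that divides `n`, then `p` divides neither
`n.choose (p ^ a)` nor `(n - 1 + p ^ a).choose (p ^ a)`. -/
theorem exists_not_dvd_choose {p : ℕ} (hp : p.Prime) {n : ℕ} (hn : n ≠ 0) :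
    ∃ a c, n = p ^ a * c ∧ c ≠ 0 ∧ ¬ p ∣ n.choose (p ^ a) ∧
      ¬ p ∣ (n - 1 + p ^ a).choose (p ^ a) := by
  obtain ⟨a, c, hc, rfl⟩ := Nat.exists_eq_pow_mul_and_not_dvd hn p hp.ne_one
  have hpa : 0 < p ^ a := pow_pos hp.pos a
  have hc0 : c ≠ 0 := by rintro rfl; exact hc (dvd_zero p)
  refine ⟨a, c, rfl, hc0, fun h => hc ?_, fun h => hc ?_⟩
  · exact ((choose_prime_pow_modEq hp a c 0 hpa).dvd_iff (dvd_refl p)).1 h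
  · have e : p ^ a * c - 1 + p ^ a = p ^ a * c + (p ^ a - 1) := by
      have : 0 < p ^ a * c := by positivity
      omega
    rw [e] at h
    exact ((choose_prime_pow_modEq hp a c _ (by omega)).dvd_iff (dvd_refl p)).1 h

variable {F : Type*} [Field F]

/-- Pascal's rule; it turns the signs forced by skew-symmetry into divisibility by `p` in the next
row. -/
theorem choose_eq_zero_of_choose_pred {n k : ℕ} (hn : n ≠ 0)
    (h : ((n - 1).choose k : F) = (-1) ^ k)
    (h' : ((n - 1).choose (k + 1) : F) = (-1) ^ (k + 1)) : (n.choose (k + 1) : F) = 0 := by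
  obtain ⟨n, rfl⟩ := Nat.exists_eq_succ_of_ne_zero hn
  simp only [Nat.succ_eq_add_one, Nat.add_sub_cancel] at h h'
  rw [Nat.succ_eq_add_one, Nat.choose_succ_succ, Nat.cast_add, h, h', pow_succ]
  ring

theorem choose_prime_pow_sub_one {p : ℕ} [CharP F p] (hp : p.Prime) (s k : ℕ) (hk : k < p ^ s) :
    ((p ^ s - 1).choose k : F) = (-1) ^ k := by
  induction k with
  | zero => simp
  | succ k ih =>
    have h : ((p ^ s).choose (k + 1) : F) = 0 :=
      (CharP.cast_eq_zero_iff F p _).2 (hp.dvd_choose_pow (by omega) (by omega))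
    obtain ⟨n, hn⟩ := Nat.exists_eq_succ_of_ne_zero (pow_pos hp.pos s).ne'
    rw [hn, Nat.succ_eq_add_one, Nat.choose_succ_succ, Nat.cast_add] at h
    have ih := ih (by omega)
    rw [hn, Nat.succ_eq_add_one, Nat.add_sub_cancel] at ih ⊢
    rw [ih] at h
    rw [pow_succ]
    linear_combination h

end Binomial

/-! ### Iterated right brackets -/

section RightBracket

variable {F N : Type*} [Field F] [LieRing N] [LieAlgebra F N]

variable (F) in
/-- The operator `u ↦ ⁅u, x⁆`. -/
def bracketRight (x : N) : Module.End F N := -LieAlgebra.ad F N x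

theorem bracketRight_apply (x u : N) : bracketRight F x u = ⁅u, x⁆ := by
  simp [bracketRight]

theorem bracketRight_pow_succ (x u : N) (k : ℕ) :
    (bracketRight F x ^ (k + 1)) u = ⁅(bracketRight F x ^ k) u, x⁆ := by
  rw [pow_succ', Module.End.mul_apply, bracketRight_apply]

theorem bracketRight_pow_succ' (x u : N) (k : ℕ) :
    (bracketRight F x ^ (k + 1)) u = (bracketRight F x ^ k) ⁅u, x⁆ := by
  rw [pow_succ, Module.End.mul_apply, bracketRight_apply]

/-- The generalized Jacobi identity. -/
theorem lie_bracketRight_pow (u v x : N) (k : ℕ) :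
    ⁅u, (bracketRight F x ^ k) v⁆ = ∑ ij ∈ Finset.HasAntidiagonal.antidiagonal k,
      k.choose ij.1 • ((-1 : F) ^ ij.1 •
        (bracketRight F x ^ ij.2) ⁅(bracketRight F x ^ ij.1) u, v⁆) := by
  induction k generalizing u with
  | zero => simp
  | succ k ih =>
    have key : ⁅u, (bracketRight F x ^ (k + 1)) v⁆ =
        bracketRight F x ⁅u, (bracketRight F x ^ k) v⁆ - ⁅⁅u, x⁆, (bracketRight F x ^ k) v⁆ := by
      rw [bracketRight_pow_succ, bracketRight_apply, leibniz_lie u, sub_eq_add_neg, lie_skew]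
    rw [Finset.sum_antidiagonal_choose_succ_nsmul
      (fun i j => (-1 : F) ^ i • (bracketRight F x ^ j) ⁅(bracketRight F x ^ i) u, v⁆), key, ih,
      ih ⁅u, x⁆, sub_eq_add_neg, map_sum, ← Finset.sum_neg_distrib]
    congr 1
    · refine Finset.sum_congr rfl fun ij _ => ?_
      rw [map_nsmul, map_smul, pow_succ' _ ij.2, Module.End.mul_apply]
    · refine Finset.sum_congr rfl fun ij hij => ?_
      -- This half of the Pascal splitting carries the coefficient `k.choose ij.2`.
      have : k.choose ij.1 = k.choose ij.2 := by
        rw [← Finset.HasAntidiagonal.mem_antidiagonal.1 hij, Nat.choose_symm_add]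
      rw [bracketRight_pow_succ', pow_succ, mul_neg_one, neg_smul, smul_neg, this]

/-- The form in which the Jacobi expansion is used: within a short range of degrees at most one term
survives. -/
theorem lie_bracketRight_pow_eq_of_forall_ne {u v x : N} {k : ℕ} (t : ℕ) (ht : t ≤ k)
    (h : ∀ s ≤ k, s ≠ t → ⁅(bracketRight F x ^ s) u, v⁆ = 0) :
    ⁅u, (bracketRight F x ^ k) v⁆ = ((-1 : F) ^ t * k.choose t) •
      (bracketRight F x ^ (k - t)) ⁅(bracketRight F x ^ t) u, v⁆ := by
  rw [lie_bracketRight_pow, Finset.sum_eq_single (t, k - t)]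
  · rw [mul_comm, mul_smul, Nat.cast_smul_eq_nsmul]
  · rintro ⟨i, j⟩ hij hne
    have hij := Finset.HasAntidiagonal.mem_antidiagonal.1 hij
    simp only at hij
    have : i ≠ t := by
      rintro rfl
      exact hne (by rw [← hij, Nat.add_sub_cancel_left])
    simp only [h i (by omega) this, map_zero, smul_zero]
  · intro hn
    exact absurd (Finset.HasAntidiagonal.mem_antidiagonal.2 (by simp only; omega)) hn

theorem lie_bracketRight_pow_eq_zero {u v x : N} {k : ℕ}
    (h : ∀ s ≤ k, ⁅(bracketRight F x ^ s) u, v⁆ = 0) :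
    ⁅u, (bracketRight F x ^ k) v⁆ = 0 := by
  rw [lie_bracketRight_pow_eq_of_forall_ne k le_rfl fun s hs _ => h s hs, h k le_rfl, map_zero,
    smul_zero]

/-- In characteristic `p`, the `p ^ s`-th power of `u ↦ ⁅u, x⁆` is a derivation. -/
theorem bracketRight_prime_pow_lie {p : ℕ} [CharP F p] (hp : p.Prime) (hp2 : p ≠ 2) (s : ℕ)
    (u v x : N) :
    (bracketRight F x ^ p ^ s) ⁅u, v⁆ =
      ⁅u, (bracketRight F x ^ p ^ s) v⁆ + ⁅(bracketRight F x ^ p ^ s) u, v⁆ := by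
  have hq : p ^ s ≠ 0 := (pow_pos hp.pos s).ne'
  have hodd : Odd (p ^ s) := (hp.odd_of_ne_two hp2).pow
  rw [lie_bracketRight_pow, Finset.sum_eq_add (0, p ^ s) (p ^ s, 0)]
  · simp [hodd.neg_one_pow, -lie_skew]
  · simp [hq.symm]
  · rintro ⟨i, j⟩ hij ⟨h1, h2⟩
    have hij := Finset.HasAntidiagonal.mem_antidiagonal.1 hij
    simp only at hij
    have : p ∣ (p ^ s).choose i := hp.dvd_choose_pow
      (by rintro rfl; exact h1 (by simp_all)) (by rintro rfl; exact h2 (by simp_all))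
    rw [← Nat.cast_smul_eq_nsmul F, (CharP.cast_eq_zero_iff F p _).2 this, zero_smul]
  · simp
  · simp

end RightBracket

/-! ### Length of a first constituent -/

section FirstConstituent

/-- The arithmetic behind the length of the first constituent. -/
theorem eq_two_mul_prime_pow_of_choose_eq_zero {p : ℕ} (hp : p.Prime) (hp2 : p ≠ 2) {n l : ℕ}
    (hn : n ≠ 0) (heven : Even n) (hl : l ≠ 0)
    (h1 : ∀ k, 0 < k → k < l → p ∣ n.choose k)
    (h2 : ∀ t, 0 < t → l + t < n → p ∣ (l - 1 + t).choose t) : ∃ s, n = 2 * p ^ s := by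
  obtain ⟨s, c, hnc, hc, hs, -⟩ := exists_not_dvd_choose hp hn
  obtain ⟨a, b, hlb, hb, -, ha⟩ := exists_not_dvd_choose hp hl
  have hs' : l ≤ p ^ s := by
    by_contra! h
    exact hs (h1 _ (pow_pos hp.pos s) h)
  have ha' : n ≤ l + p ^ a := by
    by_contra! h
    exact ha (h2 _ (pow_pos hp.pos a) h)
  have hal : p ^ a ≤ l := hlb ▸ Nat.le_mul_of_pos_right _ (Nat.pos_of_ne_zero hb)
  have hc2 : Even c := by
    rw [hnc, Nat.even_mul] at heven
    exact heven.resolve_left (Nat.not_even_iff_odd.2 ((hp.odd_of_ne_two hp2).pow))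
  obtain ⟨d, rfl⟩ := hc2
  have hd : 1 ≤ d := by omega
  refine ⟨s, ?_⟩
  -- This closes the chain `2 p^s ≤ n ≤ l + p^a ≤ 2 l ≤ 2 p^s`.
  have := Nat.mul_le_mul_left (p ^ s) hd
  rw [mul_add] at hnc
  omega

variable {F N : Type*} [Field F] [LieRing N] [LieAlgebra F N]

/-- If `⁅y x^k, y⁆ = 0` for `k < n - 1`, `y x^n = 0` and `w = ⁅y x^(n-1), y⁆` is nonzero, and if no
nonzero `w x^k` is centralized by both `x` and `y`, then `n` is twice a power of the odd
characteristic. -/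
theorem exists_eq_two_mul_prime_pow {p : ℕ} [CharP F p] (hp : p.Prime) (hp2 : p ≠ 2)
    {x y w : N} {n : ℕ} (hn : n ≠ 0)
    (hy : ∀ k, k + 1 < n → ⁅(bracketRight F x ^ k) y, y⁆ = 0)
    (hx : (bracketRight F x ^ n) y = 0)
    (hw : w = ⁅(bracketRight F x ^ (n - 1)) y, y⁆) (hw0 : w ≠ 0)
    (hnd : ∀ k, (bracketRight F x ^ k) w ≠ 0 →
      (bracketRight F x ^ (k + 1)) w ≠ 0 ∨ ⁅(bracketRight F x ^ k) w, y⁆ ≠ 0) :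
    ∃ s, n = 2 * p ^ s := by
  obtain ⟨d, rfl⟩ := Nat.exists_eq_succ_of_ne_zero hn
  simp only [Nat.succ_eq_add_one, Nat.add_sub_cancel] at *
  have hy' : ∀ k, k ≠ d → ⁅(bracketRight F x ^ k) y, y⁆ = 0 := by
    intro k hk
    rcases lt_or_gt_of_ne hk with h | h
    · exact hy k (by omega)
    · rw [← Nat.sub_add_cancel (show d + 1 ≤ k from h), pow_add, Module.End.mul_apply, hx,
        map_zero, zero_lie]
  -- The bracket of `y x^d` with `y x^k`, expanded in both orders, has a single surviving term each
  -- time; skew-symmetry compares the coefficients.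
  have hsgn : ∀ k ≤ d, (bracketRight F x ^ k) w ≠ 0 → (-1 : F) ^ (d - k) * d.choose k = -1 := by
    intro k hk hwk
    have e1 : ⁅(bracketRight F x ^ d) y, (bracketRight F x ^ k) y⁆ = (bracketRight F x ^ k) w := by
      rw [lie_bracketRight_pow_eq_of_forall_ne 0 (Nat.zero_le k), hw]
      · simp
      · intro s _ hs
        rw [← Module.End.mul_apply, ← pow_add]
        exact hy' _ (by omega)
    have e2 : ⁅(bracketRight F x ^ k) y, (bracketRight F x ^ d) y⁆ =
        ((-1 : F) ^ (d - k) * d.choose k) • (bracketRight F x ^ k) w := by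
      rw [lie_bracketRight_pow_eq_of_forall_ne (d - k) (Nat.sub_le d k), hw,
        Nat.choose_symm hk, Nat.sub_sub_self hk, ← Module.End.mul_apply _ _ y, ← pow_add,
        Nat.sub_add_cancel hk]
      intro s _ hs
      rw [← Module.End.mul_apply, ← pow_add]
      exact hy' _ (by omega)
    rw [← lie_skew, e1] at e2
    have : ((-1 : F) ^ (d - k) * d.choose k + 1) • (bracketRight F x ^ k) w = 0 := by
      rw [add_smul, ← e2, one_smul, neg_add_cancel]
    exact eq_neg_of_add_eq_zero_left ((smul_eq_zero.1 this).resolve_right hwk)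
  have hd : (-1 : F) ^ d = -1 := by simpa using hsgn 0 (Nat.zero_le d) (by simpa using hw0)
  have h2F : (1 : F) ≠ -1 := fun h => by
    have h2 : ((2 : ℕ) : F) = 0 := by push_cast; linear_combination h
    exact hp2 ((Nat.prime_dvd_prime_iff_eq hp Nat.prime_two).1
      ((CharP.cast_eq_zero_iff F p 2).1 h2))
  have heven : Even (d + 1) := by
    rcases Nat.even_or_odd d with h | h
    · exact absurd (h.neg_one_pow.symm.trans hd) h2F
    · exact h.add_one
  have hch : ∀ k ≤ d, (bracketRight F x ^ k) w ≠ 0 → (d.choose k : F) = (-1) ^ k := by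
    intro k hk hwk
    have h := hsgn k hk hwk
    have h' : (-1 : F) ^ (d - k) * (-1) ^ k = -1 := by
      rw [← pow_add, Nat.sub_add_cancel hk, hd]
    exact mul_left_cancel₀ (pow_ne_zero (d - k) (neg_ne_zero.2 one_ne_zero)) (h.trans h'.symm)
  have hdvd : ∀ l ≤ d + 1, (∀ k < l, (bracketRight F x ^ k) w ≠ 0) →
      ∀ k, 0 < k → k < l → p ∣ (d + 1).choose k := by
    intro l hl h k hk hkl
    obtain ⟨k, rfl⟩ := Nat.exists_eq_succ_of_ne_zero hk.ne'
    simp only [Nat.succ_eq_add_one] at *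
    exact (CharP.cast_eq_zero_iff F p _).1 (choose_eq_zero_of_choose_pred hn
      (hch k (by omega) (h k (by omega))) (hch (k + 1) (by omega) (h _ hkl)))
  have hne : ∀ l, (∀ k, k + 1 < l → ⁅(bracketRight F x ^ k) w, y⁆ = 0) →
      ∀ k < l, (bracketRight F x ^ k) w ≠ 0 := by
    intro l h k
    induction k with
    | zero => exact fun _ => by simpa using hw0
    | succ k ih => exact fun hk => (hnd k (ih (by omega))).resolve_right (not_not.2 (h k hk))
  -- The `l` of the arithmetic lemma is one more than the first `k < d` for which `y` does not kill
  -- `w x^k`.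
  by_cases hex : ∃ k, ⁅(bracketRight F x ^ k) w, y⁆ ≠ 0 ∧ k < d
  · classical
    obtain ⟨hk0, hkd⟩ := Nat.find_spec hex
    have hmin : ∀ j < Nat.find hex, ⁅(bracketRight F x ^ j) w, y⁆ = 0 := fun j hj => by
      by_contra h
      exact Nat.find_min hex hj ⟨h, by omega⟩
    generalize Nat.find hex = k0 at *
    refine eq_two_mul_prime_pow_of_choose_eq_zero hp hp2 (l := k0 + 1) hn heven
      (Nat.succ_ne_zero k0)
      (hdvd _ (by omega) (hne _ fun j hj => hmin j (by omega))) fun t ht htl => ?_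
    rw [Nat.add_sub_cancel]
    have hz : ⁅(bracketRight F x ^ (k0 + t)) y, y⁆ = 0 := hy' _ (by omega)
    have hu : ⁅(bracketRight F x ^ (d - t)) y, y⁆ = 0 := hy' _ (by omega)
    -- Both factors commute with `y`, so their bracket does too; that bracket is `± C(k0 + t, t) w
    -- x^k0`.
    have hj := leibniz_lie ((bracketRight F x ^ (d - t)) y) ((bracketRight F x ^ (k0 + t)) y) y
    rw [hz, hu, lie_zero, lie_zero, add_zero,
      lie_bracketRight_pow_eq_of_forall_ne t (Nat.le_add_left t k0), Nat.add_sub_cancel,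
      ← Module.End.mul_apply _ _ y, ← pow_add, Nat.add_sub_cancel' (by omega), ← hw,
      smul_lie] at hj
    · have := (smul_eq_zero.1 hj.symm).resolve_right hk0
      exact (CharP.cast_eq_zero_iff F p _).1
        ((mul_eq_zero.1 this).resolve_left (pow_ne_zero t (neg_ne_zero.2 one_ne_zero)))
    · intro s _ hs
      rw [← Module.End.mul_apply, ← pow_add]
      exact hy' _ (by omega)
  · push Not at hex
    -- With `l = n` the second family of divisibilities is vacuous.
    exact eq_two_mul_prime_pow_of_choose_eq_zero hp hp2 (l := d + 1) hn heven hn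
      (hdvd _ le_rfl (hne _ fun k hk => by
        by_contra h
        exact absurd (hex k h) (by omega))) fun t ht htl => by omega

end FirstConstituent

/-! ### Two-step centralizers and constituent lengths -/

section TwoStepCentralizers

variable {F L : Type*} [Field F] [LieRing L] [LieAlgebra F L] {𝒜 : ℕ → Submodule F L}

variable (𝒜) in
/-- `y` and `x` span the first two two-step centralizers `C_2` and `C_{2q}` of an
infinite-dimensional algebra of maximal class; the fields record how they act. -/
structure IsStandardPair (q : ℕ) (x y : L) : Prop where
  isParameter : IsParameter 𝒜 q
  x_mem : x ∈ 𝒜 1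
  y_mem : y ∈ 𝒜 1
  lie_ne_zero : ⁅y, x⁆ ≠ 0
  exists_ne_zero : ∀ i, 1 ≤ i → ∃ u ∈ 𝒜 i, u ≠ 0
  lie_y : ∀ ⦃i u⦄, u ∈ 𝒜 i → twoStepCentralizer 𝒜 i = twoStepCentralizer 𝒜 2 → ⁅u, y⁆ = 0
  lie_x : ∀ ⦃i u⦄, u ∈ 𝒜 i → twoStepCentralizer 𝒜 i = twoStepCentralizer 𝒜 (2 * q) → ⁅u, x⁆ = 0
  lie_y_ne_zero : ∀ ⦃i u⦄, 2 ≤ i → u ∈ 𝒜 i → u ≠ 0 →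
    twoStepCentralizer 𝒜 i ≠ twoStepCentralizer 𝒜 2 → ⁅u, y⁆ ≠ 0
  lie_x_ne_zero : ∀ ⦃i u⦄, 2 ≤ i → u ∈ 𝒜 i → u ≠ 0 →
    twoStepCentralizer 𝒜 i = twoStepCentralizer 𝒜 2 → ⁅u, x⁆ ≠ 0

namespace IsStandardPair

variable {q : ℕ} {x y : L}

theorem two_le (h : IsStandardPair 𝒜 q x y) : 2 ≤ q := by
  have h1 := h.isParameter.1
  have h2 : q ≠ 1 := by
    rintro rfl
    exact h.isParameter.2.1 rfl
  omega

theorem two_mul_le (h : IsStandardPair 𝒜 q x y) {i : ℕ} (hi : 2 ≤ i)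
    (hC : twoStepCentralizer 𝒜 i ≠ twoStepCentralizer 𝒜 2) : 2 * q ≤ i := by
  by_contra! hlt
  exact hC (h.isParameter.2.2 i hi hlt)

end IsStandardPair
variable [GradedLieAlgebra 𝒜]

namespace IsMaximalClass

/-- By the Leibniz rule, stability under brackets with `𝒜 1` passes to everything `𝒜 1` generates.
-/
theorem eq_top_of_lie_mem (hL : IsMaximalClass 𝒜) (S : Submodule F L) (h1 : 𝒜 1 ≤ S)
    (h2 : ∀ u ∈ 𝒜 1, ∀ s ∈ S, ⁅s, u⁆ ∈ S) : S = ⊤ := by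
  have key : ∀ a ∈ LieSubalgebra.lieSpan F L (𝒜 1 : Set L), ∀ s ∈ S, ⁅s, a⁆ ∈ S := by
    intro a ha
    induction ha using LieSubalgebra.lieSpan_induction with
    | mem a ha => exact h2 a ha
    | zero => exact fun s _ => by rw [lie_zero]; exact S.zero_mem
    | add a b _ _ iha ihb => exact fun s hs => by rw [lie_add]; exact S.add_mem (iha s hs) (ihb s hs)
    | smul r a _ ih => exact fun s hs => by rw [lie_smul]; exact S.smul_mem r (ih s hs)
    | lie a b _ _ iha ihb =>
      intro s hs
      rw [leibniz_lie, ← lie_skew a]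
      exact S.add_mem (ihb _ (iha s hs)) (S.neg_mem (iha _ (ihb s hs)))
  have key' : ∀ a ∈ LieSubalgebra.lieSpan F L (𝒜 1 : Set L), a ∈ S := by
    intro a ha
    induction ha using LieSubalgebra.lieSpan_induction with
    | mem a ha => exact h1 ha
    | zero => exact S.zero_mem
    | add a b _ _ iha ihb => exact S.add_mem iha ihb
    | smul r a _ ih => exact S.smul_mem r ih
    | lie a b _ hb iha _ => exact key b hb a iha
  exact eq_top_iff.2 fun a _ => key' a (by rw [hL.generated]; exact LieSubalgebra.mem_top a)

theorem finiteDimensional (hL : IsMaximalClass 𝒜) (i : ℕ) : FiniteDimensional F (𝒜 i) := by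
  refine Module.rank_lt_aleph0_iff.1 ?_
  match i with
  | 0 => rw [hL.zero_eq_bot, rank_bot]; exact Cardinal.aleph0_pos
  | 1 => rw [hL.rank_one]; exact Cardinal.ofNat_lt_aleph0
  | i + 2 => exact (hL.rank_le_one _ (by omega)).trans_lt Cardinal.one_lt_aleph0

/-- Otherwise the sum of the first `i` components is stable under `𝒜 1`, hence all of `L`, which
would be finite-dimensional. -/
theorem exists_lie_ne_zero (hL : IsMaximalClass 𝒜) (hinf : ¬ FiniteDimensional F L) {i : ℕ}
    (hi : 1 ≤ i) : ∃ u ∈ 𝒜 i, ∃ v ∈ 𝒜 1, ⁅u, v⁆ ≠ 0 := by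
  by_contra! h
  have := hL.finiteDimensional
  let S := (Finset.Icc 1 i).sup 𝒜
  have hS : S = ⊤ := by
    refine hL.eq_top_of_lie_mem S (Finset.le_sup (Finset.mem_Icc.2 ⟨le_rfl, hi⟩)) fun v hv => ?_
    suffices S ≤ S.comap (bracketRight F v) from fun s hs => by
      simpa only [Submodule.mem_comap, bracketRight_apply] using this hs
    refine Finset.sup_le fun j hj u hu => ?_
    rw [Submodule.mem_comap, bracketRight_apply]
    rw [Finset.mem_Icc] at hj
    rcases hj.2.eq_or_lt with rfl | hji
    · rw [h u hu v hv]
      exact S.zero_mem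
    · exact Finset.le_sup (f := 𝒜) (Finset.mem_Icc.2 ⟨by omega, by omega⟩)
        (SetLike.GradedBracket.bracket_mem hu hv)
  have hfin : FiniteDimensional F S := Submodule.finiteDimensional_finset_sup _ _
  rw [hS] at hfin
  exact hinf (Module.Finite.equiv (Submodule.topEquiv (R := F) (M := L)))

theorem exists_ne_zero (hL : IsMaximalClass 𝒜) (hinf : ¬ FiniteDimensional F L) {i : ℕ}
    (hi : 1 ≤ i) : ∃ u ∈ 𝒜 i, u ≠ 0 := by
  obtain ⟨u, hu, v, -, huv⟩ := hL.exists_lie_ne_zero hinf hi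
  exact ⟨u, hu, by rintro rfl; exact huv (zero_lie v)⟩

theorem exists_smul_eq (hL : IsMaximalClass 𝒜) {i : ℕ} (hi : 2 ≤ i) {u v : L} (hu : u ∈ 𝒜 i)
    (hu0 : u ≠ 0) (hv : v ∈ 𝒜 i) : ∃ c : F, v = c • u := by
  obtain ⟨b, hb⟩ := rank_le_one_iff.1 (hL.rank_le_one i hi)
  obtain ⟨r, hr⟩ := hb ⟨u, hu⟩
  obtain ⟨r', hr'⟩ := hb ⟨v, hv⟩
  rw [Subtype.ext_iff] at hr hr'
  simp only [Submodule.coe_smul] at hr hr'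
  have hr0 : r ≠ 0 := by
    rintro rfl
    exact hu0 (by rw [← hr, zero_smul])
  exact ⟨r' * r⁻¹, by rw [← hr, ← hr', smul_smul, mul_assoc, inv_mul_cancel₀ hr0, mul_one]⟩

theorem exists_lie_ne_zero_of_ne_zero (hL : IsMaximalClass 𝒜) (hinf : ¬ FiniteDimensional F L)
    {i : ℕ} (hi : 2 ≤ i) {u : L} (hu : u ∈ 𝒜 i) (hu0 : u ≠ 0) : ∃ v ∈ 𝒜 1, ⁅u, v⁆ ≠ 0 := by
  obtain ⟨u', hu', v, hv, huv⟩ := hL.exists_lie_ne_zero hinf (show 1 ≤ i by omega)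
  obtain ⟨c, rfl⟩ := hL.exists_smul_eq hi hu hu0 hu'
  exact ⟨v, hv, fun h => huv (by rw [smul_lie, h, smul_zero])⟩

theorem exists_eq_smul_add_smul (hL : IsMaximalClass 𝒜) {a b v : L} (ha : a ∈ 𝒜 1)
    (hb : b ∈ 𝒜 1) (ha0 : a ≠ 0) (hab : ∀ c : F, c • a ≠ b) (hv : v ∈ 𝒜 1) :
    ∃ r s : F, v = r • a + s • b := by
  have := hL.finiteDimensional 1
  have hli : LinearIndependent F ![a, b] := (LinearIndependent.pair_iff' ha0).2 hab
  have hle : Submodule.span F (Set.range ![a, b]) ≤ 𝒜 1 := by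
    rw [Submodule.span_le]
    rintro _ ⟨j, rfl⟩
    fin_cases j
    exacts [ha, hb]
  have heq : Submodule.span F (Set.range ![a, b]) = 𝒜 1 := by
    refine Submodule.eq_of_le_of_finrank_eq hle ?_
    rw [finrank_span_eq_card hli, Module.finrank, hL.rank_one]
    simp
  rw [← heq, Matrix.range_cons, Matrix.range_cons, Matrix.range_empty, Set.union_empty,
    Set.singleton_union, Submodule.mem_span_pair] at hv
  obtain ⟨r, s, h⟩ := hv
  exact ⟨r, s, h.symm⟩

theorem exists_forall_smul_ne (hL : IsMaximalClass 𝒜) (a : L) : ∃ b ∈ 𝒜 1, ∀ c : F, c • a ≠ b := by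
  by_contra! h
  have hle : 𝒜 1 ≤ Submodule.span F {a} := fun b hb =>
    Submodule.mem_span_singleton.2 (h b hb)
  have h1 := (Submodule.rank_mono hle).trans (rank_span_le _)
  rw [hL.rank_one, Cardinal.mk_singleton] at h1
  exact absurd h1 (by norm_num)

theorem exists_mem_twoStepCentralizer (hL : IsMaximalClass 𝒜) (hinf : ¬ FiniteDimensional F L)
    {i : ℕ} (hi : 2 ≤ i) : ∃ c ∈ twoStepCentralizer 𝒜 i, c ≠ 0 := by
  obtain ⟨u, hu, hu0⟩ := hL.exists_ne_zero hinf (show 1 ≤ i by omega)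
  obtain ⟨a, ha, hua⟩ := hL.exists_lie_ne_zero_of_ne_zero hinf hi hu hu0
  obtain ⟨b, hb, hab⟩ := hL.exists_forall_smul_ne a
  obtain ⟨c, hc⟩ := hL.exists_smul_eq (show 2 ≤ i + 1 by omega)
    (SetLike.GradedBracket.bracket_mem hu ha) hua (SetLike.GradedBracket.bracket_mem hu hb)
  refine ⟨b - c • a, ⟨(𝒜 1).sub_mem hb ((𝒜 1).smul_mem c ha), fun v hv => ?_⟩,
    fun h => hab c (sub_eq_zero.1 h).symm⟩
  obtain ⟨r, rfl⟩ := hL.exists_smul_eq hi hu hu0 hv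
  rw [smul_lie, lie_sub, lie_smul, hc, sub_self, smul_zero]

/-- An element of `C_i` independent of `c` would, with `c`, span `𝒜 1`, so all of `𝒜 1` would kill
`𝒜 i`. -/
theorem twoStepCentralizer_le (hL : IsMaximalClass 𝒜) (hinf : ¬ FiniteDimensional F L)
    {i j : ℕ} (hi : 2 ≤ i) {c : L} (hc0 : c ≠ 0) (hci : c ∈ twoStepCentralizer 𝒜 i)
    (hcj : c ∈ twoStepCentralizer 𝒜 j) : twoStepCentralizer 𝒜 i ≤ twoStepCentralizer 𝒜 j := by
  intro b hb
  by_cases h : ∃ r : F, r • c = b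
  · obtain ⟨r, rfl⟩ := h
    exact Submodule.smul_mem _ r hcj
  · push Not at h
    obtain ⟨u, hu, v, hv, huv⟩ := hL.exists_lie_ne_zero hinf (show 1 ≤ i by omega)
    obtain ⟨r, s, rfl⟩ := hL.exists_eq_smul_add_smul hci.1 hb.1 hc0 h hv
    exact absurd (by rw [lie_add, lie_smul, lie_smul, hci.2 u hu, hb.2 u hu, smul_zero, smul_zero,
      add_zero]) huv

theorem twoStepCentralizer_eq (hL : IsMaximalClass 𝒜) (hinf : ¬ FiniteDimensional F L)
    {i j : ℕ} (hi : 2 ≤ i) (hj : 2 ≤ j) {c : L} (hc0 : c ≠ 0)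
    (hci : c ∈ twoStepCentralizer 𝒜 i) (hcj : c ∈ twoStepCentralizer 𝒜 j) :
    twoStepCentralizer 𝒜 i = twoStepCentralizer 𝒜 j :=
  le_antisymm (hL.twoStepCentralizer_le hinf hi hc0 hci hcj)
    (hL.twoStepCentralizer_le hinf hj hc0 hcj hci)

/-- An element of `𝒜 1` that centralizes a nonzero element of `𝒜 i` lies in `C_i`. -/
theorem mem_twoStepCentralizer (hL : IsMaximalClass 𝒜) {i : ℕ} (hi : 2 ≤ i) {u a : L}
    (hu : u ∈ 𝒜 i) (hu0 : u ≠ 0) (ha : a ∈ 𝒜 1) (h : ⁅u, a⁆ = 0) :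
    a ∈ twoStepCentralizer 𝒜 i := by
  refine ⟨ha, fun v hv => ?_⟩
  obtain ⟨r, rfl⟩ := hL.exists_smul_eq hi hu hu0 hv
  rw [smul_lie, h, smul_zero]

end IsMaximalClass

/-- Distinct two-step centralizers share no nonzero element, so nonzero elements of `C_2` and
`C_{2q}` form a basis of `𝒜 1`. -/
theorem IsMaximalClass.exists_isStandardPair (hL : IsMaximalClass 𝒜)
    (hinf : ¬ FiniteDimensional F L) {q : ℕ} (hq : IsParameter 𝒜 q) :
    ∃ x y, IsStandardPair 𝒜 q x y := by
  obtain ⟨y, hy, hy0⟩ := hL.exists_mem_twoStepCentralizer hinf le_rfl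
  obtain ⟨x, hx, hx0⟩ := hL.exists_mem_twoStepCentralizer hinf hq.1
  have hxy : x ∉ twoStepCentralizer 𝒜 2 := fun h =>
    hq.2.1 (hL.twoStepCentralizer_eq hinf hq.1 le_rfl hx0 hx h)
  have hspan : ∀ v ∈ 𝒜 1, ∃ r s : F, v = r • x + s • y := fun v hv =>
    hL.exists_eq_smul_add_smul hx.1 hy.1 hx0 (fun c h => hxy <| by
      have hc : c ≠ 0 := by
        rintro rfl
        exact hy0 (by rw [← h, zero_smul])
      have : x = c⁻¹ • y := by rw [← h, smul_smul, inv_mul_cancel₀ hc, one_smul]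
      exact this ▸ Submodule.smul_mem _ _ hy) hv
  refine ⟨x, y, hq, hx.1, hy.1, fun h => ?_, fun i hi => hL.exists_ne_zero hinf hi,
    fun i u hu h => (h ▸ hy).2 u hu, fun i u hu h => (h ▸ hx).2 u hu, fun i u hi hu hu0 h h' => ?_,
    fun i u hi hu hu0 h h' => ?_⟩
  · obtain ⟨u, hu, v, hv, huv⟩ := hL.exists_lie_ne_zero hinf le_rfl
    obtain ⟨r, s, rfl⟩ := hspan u hu
    obtain ⟨r', s', rfl⟩ := hspan v hv
    have h' : ⁅x, y⁆ = 0 := by rw [← lie_skew, h, neg_zero]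
    exact huv (by simp [h, h'])
  · exact h (hL.twoStepCentralizer_eq hinf hi le_rfl hy0
      (hL.mem_twoStepCentralizer hi hu hu0 hy.1 h') hy)
  · exact hxy (h ▸ hL.mem_twoStepCentralizer hi hu hu0 hx.1 h')

theorem bracketRight_pow_mem {i j : ℕ} {u x : L} (hu : u ∈ 𝒜 i) (hx : x ∈ 𝒜 j) (k : ℕ) :
    (bracketRight F x ^ k) u ∈ 𝒜 (i + k * j) := by
  induction k with
  | zero => simpa using hu
  | succ k ih =>
    rw [bracketRight_pow_succ, add_mul, one_mul, ← add_assoc]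
    exact SetLike.GradedBracket.bracket_mem ih hx

namespace IsStandardPair

variable {q : ℕ} {x y : L}

theorem pow_mem (h : IsStandardPair 𝒜 q x y) {i : ℕ} {u : L} (hu : u ∈ 𝒜 i) (k : ℕ) :
    (bracketRight F x ^ k) u ∈ 𝒜 (i + k) := by
  simpa using bracketRight_pow_mem hu h.x_mem k

theorem pow_ne_zero (h : IsStandardPair 𝒜 q x y) {i : ℕ} {u : L} (hi : 2 ≤ i) (hu : u ∈ 𝒜 i)
    (hu0 : u ≠ 0) (k : ℕ)
    (hC : ∀ s < k, twoStepCentralizer 𝒜 (i + s) = twoStepCentralizer 𝒜 2) :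
    (bracketRight F x ^ k) u ≠ 0 := by
  induction k with
  | zero => simpa using hu0
  | succ k ih =>
    rw [bracketRight_pow_succ]
    exact h.lie_x_ne_zero (by omega) (h.pow_mem hu k) (ih fun s hs => hC s (by omega))
      (hC k (by omega))

theorem y_pow_mem (h : IsStandardPair 𝒜 q x y) (k : ℕ) :
    (bracketRight F x ^ k) y ∈ 𝒜 (k + 1) := by
  rw [add_comm]
  exact h.pow_mem h.y_mem k

theorem y_pow_ne_zero (h : IsStandardPair 𝒜 q x y) {k : ℕ} (hk : k < 2 * q) :
    (bracketRight F x ^ k) y ≠ 0 := by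
  cases k with
  | zero =>
    rintro h0
    simp only [pow_zero, Module.End.one_apply] at h0
    exact h.lie_ne_zero (by rw [h0, zero_lie])
  | succ k =>
    rw [bracketRight_pow_succ']
    exact h.pow_ne_zero (i := 2) le_rfl (SetLike.GradedBracket.bracket_mem h.y_mem h.x_mem)
      h.lie_ne_zero k fun s hs => h.isParameter.2.2 _ (by omega) (by omega)

theorem lie_y_pow_y (h : IsStandardPair 𝒜 q x y) {k : ℕ} (hk : k + 1 < 2 * q) :
    ⁅(bracketRight F x ^ k) y, y⁆ = 0 := by
  cases k with
  | zero => simp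
  | succ k => exact h.lie_y (h.y_pow_mem _) (h.isParameter.2.2 _ (by omega) (by omega))

/-- The parameter is a power of the characteristic. -/
theorem exists_eq_prime_pow (h : IsStandardPair 𝒜 q x y) {p : ℕ} [CharP F p] (hp : p.Prime)
    (hp2 : p ≠ 2) : ∃ s, q = p ^ s := by
  have hq := h.two_le
  have hmem : (bracketRight F x ^ (2 * q - 1)) y ∈ 𝒜 (2 * q) := by
    have := h.y_pow_mem (2 * q - 1)
    rwa [Nat.sub_add_cancel (by omega)] at this
  have hw : ⁅(bracketRight F x ^ (2 * q - 1)) y, y⁆ ∈ 𝒜 (2 * q + 1) :=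
    SetLike.GradedBracket.bracket_mem hmem h.y_mem
  obtain ⟨s, hs⟩ := exists_eq_two_mul_prime_pow (F := F) (x := x) (n := 2 * q) hp hp2 (by omega)
    (fun k hk => h.lie_y_pow_y hk)
    (by
      obtain ⟨d, hd⟩ : ∃ d, 2 * q = d + 1 := ⟨2 * q - 1, by omega⟩
      have hlie := h.lie_x hmem rfl
      rw [hd] at hlie ⊢
      rwa [bracketRight_pow_succ])
    rfl (h.lie_y_ne_zero (by omega) hmem (h.y_pow_ne_zero (by omega)) h.isParameter.2.1)
    (fun k hk => by
      by_cases hC : twoStepCentralizer 𝒜 (2 * q + 1 + k) = twoStepCentralizer 𝒜 2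
      · left
        rw [bracketRight_pow_succ]
        exact h.lie_x_ne_zero (by omega) (h.pow_mem hw k) hk hC
      · exact .inr (h.lie_y_ne_zero (by omega) (h.pow_mem hw k) hk hC))
  exact ⟨s, by omega⟩

/-- Every constituent has length at least `q`. -/
theorem twoStepCentralizer_add_eq (h : IsStandardPair 𝒜 q x y) {p : ℕ} [CharP F p]
    (hp : p.Prime) {a : ℕ} (ha : 2 ≤ a) (hC : twoStepCentralizer 𝒜 a ≠ twoStepCentralizer 𝒜 2)
    {s : ℕ} (hs : 0 < s) (hsq : s < q) :
    twoStepCentralizer 𝒜 (a + s) = twoStepCentralizer 𝒜 2 := by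
  classical
  induction a using Nat.strong_induction_on generalizing s with
  | _ a ih =>
  by_contra hCs
  have hex : ∃ l, 0 < l ∧ l < q ∧ twoStepCentralizer 𝒜 (a + l) ≠ twoStepCentralizer 𝒜 2 :=
    ⟨s, hs, hsq, hCs⟩
  obtain ⟨hl0, hlq, hl⟩ := Nat.find_spec hex
  have hmin : ∀ j < Nat.find hex, 0 < j →
      twoStepCentralizer 𝒜 (a + j) = twoStepCentralizer 𝒜 2 := fun j hj hj0 => by
    by_contra h'
    exact Nat.find_min hex hj ⟨hj0, by omega, h'⟩
  generalize Nat.find hex = l at *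
  have haq := h.two_mul_le ha hC
  have hbefore : ∀ t, 0 < t → t < q →
      twoStepCentralizer 𝒜 (a - t) = twoStepCentralizer 𝒜 2 := fun t ht htq => by
    by_contra h'
    refine hC ?_
    have := ih (a - t) (by omega) (by omega) h' ht htq
    rwa [Nat.sub_add_cancel (by omega)] at this
  -- Here `t = p^e` is the exact power of `p` in the too short gap `l`, so `C(l - 1 + t, t)` is
  -- nonzero in `F`, while `t ≤ l < q`.
  obtain ⟨e, b, hlb, hb, -, he⟩ := exists_not_dvd_choose hp hl0.ne'
  have hel : p ^ e ≤ l := hlb ▸ Nat.le_mul_of_pos_right _ (Nat.pos_of_ne_zero hb)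
  have he0 : 0 < p ^ e := pow_pos hp.pos e
  generalize p ^ e = t at *
  obtain ⟨u, hu, hu0⟩ := h.exists_ne_zero (a - t) (by omega)
  have huy : ⁅u, y⁆ = 0 := h.lie_y hu (hbefore t he0 (by omega))
  have hut : (bracketRight F x ^ t) u ∈ 𝒜 a := by
    have := h.pow_mem hu t
    rwa [Nat.sub_add_cancel (by omega)] at this
  have hut0 : (bracketRight F x ^ t) u ≠ 0 := by
    refine h.pow_ne_zero (by omega) hu hu0 t fun s hs => ?_
    rw [show a - t + s = a - (t - s) by omega]
    exact hbefore _ (by omega) (by omega)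
  have hv : ⁅(bracketRight F x ^ t) u, y⁆ ∈ 𝒜 (a + 1) :=
    SetLike.GradedBracket.bracket_mem hut h.y_mem
  have hvl := h.pow_mem hv (l - 1)
  rw [show a + 1 + (l - 1) = a + l by omega] at hvl
  have hv0 : ⁅(bracketRight F x ^ (l - 1)) ⁅(bracketRight F x ^ t) u, y⁆, y⁆ ≠ 0 := by
    refine h.lie_y_ne_zero (by omega) hvl ?_ hl
    refine h.pow_ne_zero (by omega) hv (h.lie_y_ne_zero ha hut hut0 hC) _ fun s hs => ?_
    rw [add_assoc]
    exact hmin _ (by omega) (by omega)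
  -- Since `l + t < 2q`, both `u` and `y x^(l-1+t)` commute with `y`; only the term passing through
  -- degree `a` survives, and it is nonzero.
  have hj := leibniz_lie u ((bracketRight F x ^ (l - 1 + t)) y) y
  rw [h.lie_y_pow_y (by omega), huy, lie_zero, lie_zero, add_zero,
    lie_bracketRight_pow_eq_of_forall_ne t (Nat.le_add_left t _), Nat.add_sub_cancel,
    smul_lie] at hj
  · have := (smul_eq_zero.1 hj.symm).resolve_right hv0
    exact he ((CharP.cast_eq_zero_iff F p _).1
      ((mul_eq_zero.1 this).resolve_left (_root_.pow_ne_zero t (neg_ne_zero.2 one_ne_zero))))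
  · intro s hs hst
    refine h.lie_y (h.pow_mem hu s) ?_
    rcases lt_or_gt_of_ne hst with hlt | hgt
    · rw [show a - t + s = a - (t - s) by omega]
      exact hbefore _ (by omega) (by omega)
    · rw [show a - t + s = a + (s - t) by omega]
      exact hmin _ (by omega) (by omega)

/-- No nonzero homogeneous element of degree at least `2` is annihilated both by `q` brackets
with `x` and by the bracket with `y x^(q-1)`. -/
theorem pow_ne_zero_or_lie_ne_zero (h : IsStandardPair 𝒜 q x y) {p : ℕ} [CharP F p]
    (hp : p.Prime) {e : ℕ} (hq : q = p ^ e) {i : ℕ} {u : L} (hi : 2 ≤ i) (hu : u ∈ 𝒜 i)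
    (hu0 : u ≠ 0) :
    (bracketRight F x ^ q) u ≠ 0 ∨ ⁅u, (bracketRight F x ^ (q - 1)) y⁆ ≠ 0 := by
  classical
  by_cases hex : ∃ t, t < q ∧ twoStepCentralizer 𝒜 (i + t) ≠ twoStepCentralizer 𝒜 2
  · right
    obtain ⟨htq, ht⟩ := Nat.find_spec hex
    have hmin : ∀ j < Nat.find hex,
        twoStepCentralizer 𝒜 (i + j) = twoStepCentralizer 𝒜 2 := fun j hj => by
      by_contra h'
      exact Nat.find_min hex hj ⟨by omega, h'⟩
    generalize Nat.find hex = t at *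
    -- Constituents have length at least `q`, so `t` is the only exception in the window and one
    -- term of the expansion survives.
    have hafter : ∀ s, t < s → s < q → twoStepCentralizer 𝒜 (i + s) = twoStepCentralizer 𝒜 2 :=
      fun s hs hsq => by
        have := h.twoStepCentralizer_add_eq hp (by omega) ht (s := s - t) (by omega) (by omega)
        rwa [show i + t + (s - t) = i + s by omega] at this
    rw [lie_bracketRight_pow_eq_of_forall_ne t (by omega)]
    · have hc : (-1 : F) ^ t * (q - 1).choose t ≠ 0 := by
        rw [hq, choose_prime_pow_sub_one hp e t (hq ▸ htq)]
        exact mul_ne_zero (_root_.pow_ne_zero _ (neg_ne_zero.2 one_ne_zero))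
          (_root_.pow_ne_zero _ (neg_ne_zero.2 one_ne_zero))
      refine smul_ne_zero hc ?_
      have hut := h.pow_mem hu t
      refine h.pow_ne_zero (i := i + t + 1) (by omega)
        (SetLike.GradedBracket.bracket_mem hut h.y_mem)
        (h.lie_y_ne_zero (by omega) hut (h.pow_ne_zero hi hu hu0 t hmin) ht) _ fun s hs => ?_
      rw [show i + t + 1 + s = i + (t + 1 + s) by omega]
      exact hafter _ (by omega) (by omega)
    · intro s hs hst
      refine h.lie_y (h.pow_mem hu s) ?_
      rcases lt_or_gt_of_ne hst with hlt | hgt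
      · exact hmin s hlt
      · exact hafter s hgt (by omega)
  · push Not at hex
    exact .inl (h.pow_ne_zero hi hu hu0 q hex)

end IsStandardPair

end TwoStepCentralizers

/-! ### Deflation inside `End L` -/

section Deflation

attribute [local instance 100] LieRing.ofAssociativeRing

variable {F L : Type*} [Field F] [LieRing L] [LieAlgebra F L]

theorem bracketRight_ad_pow (u v : L) (k : ℕ) :
    (bracketRight F (LieAlgebra.ad F L v) ^ k) (LieAlgebra.ad F L u) =
      LieAlgebra.ad F L ((bracketRight F v ^ k) u) := by
  induction k with
  | zero => simp
  | succ k ih => rw [bracketRight_pow_succ, ih, bracketRight_pow_succ, LieHom.map_lie]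

/-- The commutator of `ad u` with a derivation is, up to sign, `ad` of the image of `u`; the minus
sign makes this a right action. -/
theorem lie_ad_neg_bracketRight_prime_pow {p : ℕ} [CharP F p] (hp : p.Prime) (hp2 : p ≠ 2)
    (s : ℕ) (x u : L) :
    ⁅LieAlgebra.ad F L u, -(bracketRight F x ^ p ^ s)⁆ =
      LieAlgebra.ad F L ((bracketRight F x ^ p ^ s) u) := by
  ext v
  simp only [lie_neg, Ring.lie_def, LinearMap.neg_apply, LinearMap.sub_apply,
    Module.End.mul_apply, LieAlgebra.ad_apply, bracketRight_prime_pow_lie hp hp2]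
  abel

variable {𝒜 : ℕ → Submodule F L}

theorem IsStandardPair.ad_ne_zero {q : ℕ} {x y : L} (h : IsStandardPair 𝒜 q x y) {i : ℕ} {u : L}
    (hi : 2 ≤ i) (hu : u ∈ 𝒜 i) (hu0 : u ≠ 0) : LieAlgebra.ad F L u ≠ 0 := by
  intro h0
  have hz : ∀ v : L, ⁅u, v⁆ = 0 := fun v => by rw [← LieAlgebra.ad_apply F, h0, LinearMap.zero_apply]
  by_cases hC : twoStepCentralizer 𝒜 i = twoStepCentralizer 𝒜 2
  · exact h.lie_x_ne_zero hi hu hu0 hC (hz x)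
  · exact h.lie_y_ne_zero hi hu hu0 hC (hz y)

/-- The first constituent of the deflated algebra, which is generated by the inner derivation of
`y x^(q-1)` and the `q`-th power of that of `x`, has length `m + 3`. -/
theorem IsStandardPair.exists_add_three_eq [GradedLieAlgebra 𝒜] {q : ℕ} {x y : L} (h : IsStandardPair 𝒜 q x y)
    {p : ℕ} [CharP F p] (hp : p.Prime) (hp2 : p ≠ 2) {m : ℕ}
    (hsp : ∀ j ≤ m, twoStepCentralizer 𝒜 ((j + 2) * q) = twoStepCentralizer 𝒜 (2 * q))
    (hnsp : ∀ k, 0 < k → k < 2 * q →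
      twoStepCentralizer 𝒜 ((m + 2) * q + k) = twoStepCentralizer 𝒜 2) :
    ∃ s, m + 3 = 2 * p ^ s := by
  have hq2 := h.two_le
  obtain ⟨e, hqe⟩ := h.exists_eq_prime_pow hp hp2
  set v := (bracketRight F x ^ (q - 1)) y with hv
  have hvmem : v ∈ 𝒜 q := by
    have := h.y_pow_mem (q - 1)
    rwa [Nat.sub_add_cancel (by omega)] at this
  -- The elements `y x^(2q-1) v^k`, of degree `(k + 2) q`; up to sign, their inner derivations are
  -- the iterates of `X` under `ad v`.
  set z : ℕ → L := fun k => (bracketRight F v ^ k) ((bracketRight F x ^ q) v) with hz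
  have hzsucc : ∀ k, z (k + 1) = ⁅z k, v⁆ := fun k => bracketRight_pow_succ _ _ k
  have hle : ∀ k, 2 ≤ (k + 2) * q := fun k => by
    have := Nat.mul_le_mul (show 1 ≤ k + 2 by omega) hq2
    omega
  have hzmem : ∀ k, z k ∈ 𝒜 ((k + 2) * q) := fun k => by
    have := bracketRight_pow_mem (h.pow_mem hvmem q) hvmem k
    rwa [show q + q + k * q = (k + 2) * q by ring] at this
  have hzx : ∀ k ≤ m, (bracketRight F x ^ q) (z k) = 0 := fun k hk => by
    obtain ⟨d, hd⟩ : ∃ d, q = d + 1 := ⟨q - 1, by omega⟩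
    have hzk := h.lie_x (hzmem k) (hsp k hk)
    rw [show bracketRight F x ^ q = bracketRight F x ^ (d + 1) by rw [hd],
      bracketRight_pow_succ', hzk, map_zero]
  have hz0 : ∀ k ≤ m + 1, z k ≠ 0 := by
    intro k
    induction k with
    | zero =>
      intro _
      have h0 := h.y_pow_ne_zero (k := q + (q - 1)) (by omega)
      rwa [pow_add, Module.End.mul_apply] at h0
    | succ k ih =>
      intro hk
      rw [hzsucc]
      -- Since `x^q` kills `z k`, the element `v` cannot.
      exact (h.pow_ne_zero_or_lie_ne_zero hp hqe (hle k) (hzmem k)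
        (ih (by omega))).resolve_left (not_not.2 (hzx k (by omega)))
  set X : Module.End F L := -(bracketRight F x ^ q) with hX
  have hlieX : ∀ u, ⁅LieAlgebra.ad F L u, X⁆ = LieAlgebra.ad F L ((bracketRight F x ^ q) u) :=
    fun u => by
      rw [hX, hqe]
      exact lie_ad_neg_bracketRight_prime_pow hp hp2 e x u
  have hXpow : ∀ k, (bracketRight F (LieAlgebra.ad F L v) ^ (k + 1)) X =
      -LieAlgebra.ad F L (z k) := fun k => by
    rw [bracketRight_pow_succ', ← lie_skew, hlieX, map_neg, bracketRight_ad_pow]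
  -- Degrees `(m + 3) q` to `(m + 4) q - 1` form the second half of the long constituent: there `x`
  -- acts nontrivially and `y` trivially, so `z (m + 1)` survives `x^q` but is killed by `v`.
  have hzx0 : (bracketRight F x ^ q) (z (m + 1)) ≠ 0 := by
    refine h.pow_ne_zero (hle _) (hzmem _) (hz0 _ le_rfl) q fun s hs => ?_
    rw [show (m + 1 + 2) * q + s = (m + 2) * q + (q + s) by ring]
    exact hnsp _ (by omega) (by omega)
  have hzlast : z (m + 2) = 0 := by
    rw [hzsucc]
    refine lie_bracketRight_pow_eq_zero fun s hs => h.lie_y (h.pow_mem (hzmem _) s) ?_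
    rw [show (m + 1 + 2) * q + s = (m + 2) * q + (q + s) by ring]
    exact hnsp _ (by omega) (by omega)
  have hmem := h.pow_mem (hzmem (m + 1)) q
  -- The roles are swapped: `ad v` acts as the old `x`, and the derivation `X` as the old `y`.
  refine exists_eq_two_mul_prime_pow (F := F) (x := LieAlgebra.ad F L v) (y := X)
    (w := -LieAlgebra.ad F L ((bracketRight F x ^ q) (z (m + 1)))) hp hp2 (by omega) ?_ ?_ ?_ ?_ ?_
  · intro k hk
    cases k with
    | zero => simp
    | succ k => rw [hXpow, neg_lie, hlieX, hzx k (by omega), map_zero, neg_zero]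
  · rw [hXpow, hzlast, map_zero, neg_zero]
  · rw [show m + 3 - 1 = m + 1 + 1 by omega, hXpow, neg_lie, hlieX]
  · exact neg_ne_zero.2 (h.ad_ne_zero (by omega) hmem hzx0)
  · intro k hk
    have hmemk := bracketRight_pow_mem hmem hvmem k
    have hdeg : 2 ≤ (m + 1 + 2) * q + q + k * q := by omega
    rw [map_neg, bracketRight_ad_pow] at hk
    rw [bracketRight_pow_succ, map_neg, bracketRight_ad_pow, neg_lie, neg_lie, hlieX,
      ← LieHom.map_lie, neg_ne_zero, neg_ne_zero]
    have hk0 : (bracketRight F v ^ k) ((bracketRight F x ^ q) (z (m + 1))) ≠ 0 := fun h0 =>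
      hk (by rw [h0, map_zero, neg_zero])
    rcases h.pow_ne_zero_or_lie_ne_zero hp hqe hdeg hmemk hk0 with h1 | h1
    · exact .inr (h.ad_ne_zero (by omega) (h.pow_mem hmemk q) h1)
    · exact .inl (h.ad_ne_zero (by omega) (SetLike.GradedBracket.bracket_mem hmemk hvmem) h1)

end Deflation

/-! ### From the list of lengths to the theorem -/

theorem ConstituentsFrom.replicate_append {F L : Type*} [Field F] [LieRing L] [LieAlgebra F L]
    {𝒜 : ℕ → Submodule F L} {q l m i : ℕ}
    (h : ConstituentsFrom 𝒜 i (List.replicate m q ++ [l])) :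
    (∀ j ≤ m, twoStepCentralizer 𝒜 (i + j * q) ≠ twoStepCentralizer 𝒜 2) ∧
      ∀ k, 0 < k → k < l →
        twoStepCentralizer 𝒜 (i + m * q + k) = twoStepCentralizer 𝒜 2 := by
  induction m generalizing i with
  | zero =>
    obtain ⟨⟨-, -, h1, -, h2⟩, -⟩ := h
    refine ⟨fun j hj => ?_, fun k hk hkl => ?_⟩
    · obtain rfl : j = 0 := by omega
      simpa using h1
    · simpa using h2 k hk hkl
  | succ m ih =>
    obtain ⟨h1, h2⟩ := h
    obtain ⟨ih1, ih2⟩ := ih h2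
    refine ⟨fun j hj => ?_, fun k hk hkl => ?_⟩
    · cases j with
      | zero => simpa using h1.2.2.1
      | succ j =>
        rw [show i + (j + 1) * q = i + q + j * q by ring]
        exact ih1 j (by omega)
    · rw [show i + (m + 1) * q + k = i + q + m * q + k by ring]
      exact ih2 k hk hkl

end MaxClass

theorem mainTheorem10 {p : ℕ} (hp : p.Prime) (hp2 : p ≠ 2)
    {F L : Type*} [Field F] [CharP F p] [LieRing L] [LieAlgebra F L]
    (𝒜 : ℕ → Submodule F L) [GradedLieAlgebra 𝒜] (hL : MaxClass.IsMaximalClass 𝒜)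
    (hinf : ¬ FiniteDimensional F L)
    (q m : ℕ) (hq : MaxClass.IsParameter 𝒜 q)
    (hlen : MaxClass.InitialConstituentLengths 𝒜 (2 * q :: (List.replicate m q ++ [2 * q])))
    (htwo : MaxClass.InvolvesOnlyFirstTwo 𝒜 q
      (2 * q :: (List.replicate m q ++ [2 * q])).sum) :
    ∃ k : ℕ, (m : ℤ) = 2 * (p : ℤ) ^ k - 3 := by
  obtain ⟨x, y, h⟩ := hL.exists_isStandardPair hinf hq
  obtain ⟨h1, h2⟩ := MaxClass.ConstituentsFrom.replicate_append hlen.2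
  have hq2 := h.two_le
  obtain ⟨s, hs⟩ := h.exists_add_three_eq hp hp2 (m := m)
    (fun j hj => by
      have hjm := Nat.mul_le_mul_right q hj
      have hne := h1 j hj
      rw [show 2 * q + j * q = (j + 2) * q by ring] at hne
      refine (htwo _ ?_ ?_).resolve_left hne
      · rw [add_mul]
        omega
      · simp only [List.sum_cons, List.sum_append, List.sum_replicate, smul_eq_mul, List.sum_nil]
        rw [add_mul]
        omega)
    (fun k hk hkq => by
      have := h2 k hk hkq
      rwa [show 2 * q + m * q = (m + 2) * q by ring] at this)
  refine ⟨s, ?_⟩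
  have : ((m + 3 : ℕ) : ℤ) = ((2 * p ^ s : ℕ) : ℤ) := by rw [hs]
  push_cast at this
  linarith
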